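/- Let $\mathcal D$ range over all (Borel) probability distributions of pairs $(f,y)$ on $[0,1]\times\{0,1\}$. Call $\mathcal D$ perfectly calibrated if $\mathbb E_{\mathcal D}[y\mid f]=f$ almost surely, and let $\mathcal P$ be the set of perfectly calibrated distributions. For an extended metric $\rho$ on $[0,1]\times\{0,1\}$ let $W_{1,\rho}(\mathcal D,\mathcal D')=\inf_\gamma \mathbb E_{(p,q)\sim\gamma}\,\rho(p,q)$, the infimum being over all couplings $\gamma$ of $\mathcal D$ and $\mathcal D'$. Let $$\underline{\mathrm{dCE}}(\mathcal D)=\inf_{\mathcal D'\in\mathcal P}W_{1,\rho_1}(\mathcal D,\mathcal D'),$$ where $\rho_1((f_1,y_1),(f_2,y_2))=|f_1-f_2|$ if $y_1=y_2$ and $\infty$ otherwise. A function $\mu$ that assigns a non-negative real number to each $\mathcal D$ is a consistent calibration measure (with respect to $\ell_1$) if there are constants $c_1,c_2,\alpha_1,\alpha_2>0$ such that for all $\mathcal D$ $$c_1\,\underline{\mathrm{dCE}}(\mathcal D)^{\alpha_1}\le\mu(\mathcal D)\le c_2\,\underline{\mathrm{dCE}}(\mathcal D)^{\alpha_2}.$$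 For an extended metric $d:[0,1]^2\to[0,\infty]$ let $$\mathrm{wCE}_d(\mathcal D)=\sup_w\ \mathbb E_{(f,y)\sim\mathcal D}\,(f-y)\,w(f),$$ the supremum being over all $w:[0,1]\to[-1,1]$ that are $1$-Lipschitz with respect to $d$, and let $$\underline{\mathrm{dCE}}_d(\mathcal D)=\inf_{\mathcal D'\in\mathcal P}W_{1,\rho_d}(\mathcal D,\mathcal D'),\qquad \rho_d((f_1,y_1),(f_2,y_2))=d(f_1,f_2)+|y_1-y_2|.$$ Let $d_{\mathrm{logit}}(u,v)=|\mathrm{logit}(u)-\mathrm{logit}(v)|$ on $[0,1]$, where $\mathrm{logit}(t)=\ln\frac{t}{1-t}$, $\mathrm{logit}(0)=-\infty$ and $\mathrm{logit}(1)=+\infty$; that is, each of the points $0$ and $1$ has distance $0$ to itself and $\infty$ to every other point. Then $\mathrm{wCE}_{d_{\mathrm{logit}}}$ is a consistent calibration measure with respect to $\ell_1$. Likewise $\underline{\mathrm{dCE}}_{d_{\mathrm{logit}}}$ is finite on all $\mathcal D$ and is a consistent calibration measure with respect to $\ell_1$. -/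

import Mathlib

open MeasureTheory
open scoped ENNReal

noncomputable section

namespace Calibration

/-- The space `[0,1] × {0,1}` of pairs (prediction, outcome). -/
abbrev Pair : Type := unitInterval × Bool

/-- The prediction `f ∈ [0,1]` as a real number. -/
def pred (p : Pair) : ℝ := (p.1 : ℝ)

/-- The outcome `y ∈ {0,1}` as a real number. -/
def outcome (p : Pair) : ℝ := if p.2 then 1 else 0

/-- A probability distribution on `[0,1] × {0,1}` is perfectly calibrated if `E[y | f] = f`. -/
def PerfectlyCalibrated (D : ProbabilityMeasure Pair) : Prop :=
  (D : Measure Pair)[outcome | MeasurableSpace.comap Prod.fst inferInstance]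
    =ᵐ[(D : Measure Pair)] pred

/-- `γ` is a coupling of `μ` and `ν`. -/
def IsCoupling {X : Type*} [MeasurableSpace X] (μ ν : ProbabilityMeasure X)
    (γ : Measure (X × X)) : Prop :=
  γ.map Prod.fst = (μ : Measure X) ∧ γ.map Prod.snd = (ν : Measure X)

/-- The Wasserstein distance `W₁(μ, ν)` for an extended distance `d` on `X`. -/
def wasserstein {X : Type*} [MeasurableSpace X] (d : X → X → ℝ≥0∞)
    (μ ν : ProbabilityMeasure X) : ℝ≥0∞ :=
  ⨅ (γ : Measure (X × X)) (_ : IsCoupling μ ν γ), ∫⁻ z, d z.1 z.2 ∂γ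

/-- The distance `|f₁ - f₂|` if `y₁ = y₂`, and `∞` otherwise. -/
def splitDist (p q : Pair) : ℝ≥0∞ :=
  if p.2 = q.2 then ENNReal.ofReal |pred p - pred q| else ∞

/-- The distance to calibration: the Wasserstein distance, with respect to the usual
distance on predictions and with the two intervals infinitely far apart, to the nearest
perfectly calibrated distribution. -/
def dCE (D : ProbabilityMeasure Pair) : ℝ≥0∞ :=
  ⨅ (D' : ProbabilityMeasure Pair) (_ : PerfectlyCalibrated D'), wasserstein splitDist D D'

/-- The distance `d(f₁, f₂) + |y₁ - y₂|` on `[0,1] × {0,1}`. -/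
def sumDist (d : unitInterval → unitInterval → ℝ≥0∞) (p q : Pair) : ℝ≥0∞ :=
  d p.1 q.1 + ENNReal.ofReal |outcome p - outcome q|

/-- The distance to calibration associated with an extended metric `d` on predictions. -/
def dCEOf (d : unitInterval → unitInterval → ℝ≥0∞) (D : ProbabilityMeasure Pair) : ℝ≥0∞ :=
  ⨅ (D' : ProbabilityMeasure Pair) (_ : PerfectlyCalibrated D'),
    wasserstein (sumDist d) D D'

/-- The functions `w : [0,1] → [-1,1]` that are `1`-Lipschitz with respect to `d`. -/
def testFunctions (d : unitInterval → unitInterval → ℝ≥0∞) : Set (unitInterval → ℝ) :=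
  {w | (∀ u, w u ∈ Set.Icc (-1 : ℝ) 1) ∧ ∀ u v, ENNReal.ofReal |w u - w v| ≤ d u v}

/-- The weak calibration error `sup_w E[(f - y) w(f)]` associated with `d`. -/
def wCE (d : unitInterval → unitInterval → ℝ≥0∞) (D : ProbabilityMeasure Pair) : ℝ :=
  sSup ((fun w : unitInterval → ℝ =>
    ∫ p, (pred p - outcome p) * w p.1 ∂(D : Measure Pair)) '' testFunctions d)

/-- The supremum in `wCE` is over a set that is nonempty and bounded above. -/
theorem wCE_wellDefined (d : unitInterval → unitInterval → ℝ≥0∞)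
    (D : ProbabilityMeasure Pair) :
    ((fun w : unitInterval → ℝ =>
      ∫ p, (pred p - outcome p) * w p.1 ∂(D : Measure Pair)) '' testFunctions d).Nonempty ∧
    BddAbove ((fun w : unitInterval → ℝ =>
      ∫ p, (pred p - outcome p) * w p.1 ∂(D : Measure Pair)) '' testFunctions d) := by
  refine ⟨⟨_, fun _ => 0, ⟨fun _ => by norm_num, fun _ _ => by simp⟩, rfl⟩, 1, ?_⟩
  rintro _ ⟨w, hw, rfl⟩
  have h : ‖∫ p, (pred p - outcome p) * w p.1 ∂(D : Measure Pair)‖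
      ≤ 1 * (D : Measure Pair).real Set.univ := by
    refine norm_integral_le_of_norm_le_const (Filter.Eventually.of_forall fun p => ?_)
    have h1 : |w p.1| ≤ 1 := abs_le.2 (hw.1 p.1)
    have h2 : |pred p - outcome p| ≤ 1 := by
      have h0 := p.1.2.1
      have h1 := p.1.2.2
      unfold pred outcome
      rw [abs_le]
      split_ifs <;> constructor <;> linarith
    rw [Real.norm_eq_abs, abs_mul]
    exact mul_le_one₀ h2 (abs_nonneg _) h1
  simp only [probReal_univ, mul_one] at h
  exact (le_abs_self _).trans h

/-- The metric `|logit u - logit v|` on `[0,1]`, with `logit t = log (t / (1 - t))`,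
`logit 0 = -∞` and `logit 1 = +∞`: each endpoint is at infinite distance from every
other point (and at distance `0` from itself). -/
def dLogit (u v : unitInterval) : ℝ≥0∞ :=
  if u = v then 0
  else if u = 0 ∨ u = 1 ∨ v = 0 ∨ v = 1 then ∞
  else ENNReal.ofReal
    |Real.log ((u : ℝ) / (1 - (u : ℝ))) - Real.log ((v : ℝ) / (1 - (v : ℝ)))|

/-- A nonnegative real calibration score `μ` on distributions over `[0,1] × {0,1}` is a
consistent calibration measure (with respect to `ℓ₁`) if
`c₁ dCE(D)^α₁ ≤ μ(D) ≤ c₂ dCE(D)^α₂` for all `D`, with positive constants. -/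
def IsConsistentCalibrationMeasure (μ : ProbabilityMeasure Pair → ℝ) : Prop :=
  (∀ D, 0 ≤ μ D) ∧
  ∃ c₁ c₂ α₁ α₂ : ℝ, 0 < c₁ ∧ 0 < c₂ ∧ 0 < α₁ ∧ 0 < α₂ ∧
    ∀ D : ProbabilityMeasure Pair,
      ENNReal.ofReal c₁ * dCE D ^ α₁ ≤ ENNReal.ofReal (μ D) ∧
      ENNReal.ofReal (μ D) ≤ ENNReal.ofReal c₂ * dCE D ^ α₂

end Calibration

end

open MeasureTheory
open scoped ENNReal

noncomputable section

namespace Calibration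

section Basic

theorem measurable_pred : Measurable pred := measurable_fst.subtype_val

theorem measurable_outcome : Measurable outcome :=
  (measurable_of_countable fun b : Bool => if b then (1 : ℝ) else 0).comp measurable_snd

theorem pred_nonneg (p : Pair) : 0 ≤ pred p := p.1.2.1

theorem pred_le_one (p : Pair) : pred p ≤ 1 := p.1.2.2

theorem outcome_nonneg (p : Pair) : 0 ≤ outcome p := by
  unfold outcome; split_ifs <;> norm_num

theorem outcome_le_one (p : Pair) : outcome p ≤ 1 := by
  unfold outcome; split_ifs <;> norm_num

theorem abs_pred_le_one (p : Pair) : |pred p| ≤ 1 := by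
  rw [abs_of_nonneg (pred_nonneg p)]; exact pred_le_one p

theorem abs_outcome_le_one (p : Pair) : |outcome p| ≤ 1 := by
  rw [abs_of_nonneg (outcome_nonneg p)]; exact outcome_le_one p

theorem abs_pred_sub_outcome_le (p : Pair) : |pred p - outcome p| ≤ 1 :=
  abs_le.2 ⟨by linarith [pred_nonneg p, outcome_le_one p],
    by linarith [pred_le_one p, outcome_nonneg p]⟩

theorem abs_residual_mul_le {w : unitInterval → ℝ} (hw : ∀ u, |w u| ≤ 1) (p : Pair) :
    |(pred p - outcome p) * w p.1| ≤ 1 := by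
  rw [abs_mul]
  exact mul_le_one₀ (abs_pred_sub_outcome_le p) (abs_nonneg _) (hw _)

theorem measurable_residual_mul {w : unitInterval → ℝ} (hw : Measurable w) :
    Measurable fun p : Pair => (pred p - outcome p) * w p.1 :=
  (measurable_pred.sub measurable_outcome).mul (hw.comp measurable_fst)

theorem integrable_of_abs_le {X : Type*} [MeasurableSpace X] {μ : Measure X}
    [IsFiniteMeasure μ] {f : X → ℝ} (hf : Measurable f) {C : ℝ} (hC : ∀ x, |f x| ≤ C) :
    Integrable f μ :=
  Integrable.of_bound hf.aestronglyMeasurable C (Filter.Eventually.of_forall hC)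

theorem integrable_residual_mul (D : ProbabilityMeasure Pair) {w : unitInterval → ℝ}
    (hm : Measurable w) (hw : ∀ u, |w u| ≤ 1) :
    Integrable (fun p : Pair => (pred p - outcome p) * w p.1) (D : Measure Pair) :=
  integrable_of_abs_le (measurable_residual_mul hm) (abs_residual_mul_le hw)

theorem integrable_pred (D : ProbabilityMeasure Pair) : Integrable pred (D : Measure Pair) :=
  integrable_of_abs_le measurable_pred abs_pred_le_one

theorem integrable_outcome (D : ProbabilityMeasure Pair) :
    Integrable outcome (D : Measure Pair) :=
  integrable_of_abs_le measurable_outcome abs_outcome_le_one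

/-- Under a calibrated distribution the residual is orthogonal to functions of the prediction. -/
theorem PerfectlyCalibrated.integral_residual_mul {D : ProbabilityMeasure Pair}
    (hD : PerfectlyCalibrated D) {w : unitInterval → ℝ} (hm : Measurable w)
    (hw : ∀ u, |w u| ≤ 1) :
    ∫ p, (pred p - outcome p) * w p.1 ∂(D : Measure Pair) = 0 := by
  have hle : MeasurableSpace.comap (Prod.fst : Pair → unitInterval) inferInstance ≤
      (inferInstance : MeasurableSpace Pair) := measurable_fst.comap_le
  have hwm : StronglyMeasurable[MeasurableSpace.comap (Prod.fst : Pair → unitInterval)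
      inferInstance] (fun p : Pair => w p.1) :=
    (hm.comp (comap_measurable _)).stronglyMeasurable
  have hint : ∀ {g : Pair → ℝ}, Measurable g → (∀ p, |g p| ≤ 1) →
      Integrable (g * fun p : Pair => w p.1) (D : Measure Pair) := fun hg hb =>
    integrable_of_abs_le (hg.mul (hm.comp measurable_fst)) (C := 1) fun p => by
      simp only [Pi.mul_apply, abs_mul]
      exact mul_le_one₀ (hb p) (abs_nonneg _) (hw _)
  have hio := hint measurable_outcome abs_outcome_le_one
  have hip := hint measurable_pred abs_pred_le_one
  have h1 := condExp_mul_of_stronglyMeasurable_right hwm hio (integrable_outcome D)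
  have h2 : ∫ p, (outcome * fun p : Pair => w p.1) p ∂(D : Measure Pair) =
      ∫ p, (pred * fun p : Pair => w p.1) p ∂(D : Measure Pair) := by
    rw [← integral_condExp hle]
    refine integral_congr_ae (h1.trans ?_)
    filter_upwards [hD] with p hp
    simp only [Pi.mul_apply, hp]
  have h3 : ∫ p, (pred p - outcome p) * w p.1 ∂(D : Measure Pair) =
      ∫ p, (pred * fun p : Pair => w p.1) p ∂(D : Measure Pair) -
      ∫ p, (outcome * fun p : Pair => w p.1) p ∂(D : Measure Pair) := by
    rw [← integral_sub hip hio]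
    simp [sub_mul]
  rw [h3, h2, sub_self]

theorem perfectlyCalibrated_of_setIntegral {D : ProbabilityMeasure Pair}
    (h : ∀ S : Set unitInterval, MeasurableSet S →
      ∫ p in Prod.fst ⁻¹' S, pred p ∂(D : Measure Pair) =
        ∫ p in Prod.fst ⁻¹' S, outcome p ∂(D : Measure Pair)) :
    PerfectlyCalibrated D := by
  refine (ae_eq_condExp_of_forall_setIntegral_eq measurable_fst.comap_le (integrable_outcome D)
    (fun s _ _ => (integrable_pred D).integrableOn) ?_ ?_).symm
  · rintro _ ⟨S, hS, rfl⟩ -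
    exact h S hS
  · exact (measurable_subtype_coe.comp
      (comap_measurable (Prod.fst : Pair → unitInterval))).aestronglyMeasurable

end Basic

section WeakDuality

theorem ofReal_integral_residual_le {D D' : ProbabilityMeasure Pair}
    (hD' : PerfectlyCalibrated D') {w : unitInterval → ℝ} (hm : Measurable w)
    (hw : ∀ u, |w u| ≤ 1) {ρ : Pair → Pair → ℝ≥0∞} {C : ℝ≥0∞} (hC0 : C ≠ 0) (hC : C ≠ ∞)
    (hρ : ∀ p q : Pair, ENNReal.ofReal |(pred p - outcome p) * w p.1 -
      (pred q - outcome q) * w q.1| ≤ C * ρ p q) :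
    ENNReal.ofReal (∫ p, (pred p - outcome p) * w p.1 ∂(D : Measure Pair)) ≤
      C * wasserstein ρ D D' := by
  set F : Pair → ℝ := fun p => (pred p - outcome p) * w p.1 with hF
  have hFm : Measurable F := measurable_residual_mul hm
  rw [mul_comm, ← ENNReal.div_le_iff_le_mul (Or.inl hC0) (Or.inl hC)]
  refine le_iInf₂ fun γ hγ => ?_
  rw [ENNReal.div_le_iff_le_mul (Or.inl hC0) (Or.inl hC), mul_comm]
  have hfin : IsProbabilityMeasure γ := by
    constructor
    have := congrArg (fun m => m Set.univ) hγ.1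
    simpa [Measure.map_apply measurable_fst MeasurableSet.univ] using this
  have e1 : ∫ p, F p ∂(D : Measure Pair) = ∫ z, F z.1 ∂γ := by
    rw [← hγ.1, integral_map measurable_fst.aemeasurable hFm.aestronglyMeasurable]
  have e2 : 0 = ∫ z, F z.2 ∂γ := by
    rw [← hD'.integral_residual_mul hm hw, ← hγ.2,
      integral_map measurable_snd.aemeasurable hFm.aestronglyMeasurable]
  have e3 : ∫ p, F p ∂(D : Measure Pair) = ∫ z, (F z.1 - F z.2) ∂γ := by
    rw [integral_sub, ← e2, e1, sub_zero]
    · exact integrable_of_abs_le (hFm.comp measurable_fst) fun z => abs_residual_mul_le hw z.1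
    · exact integrable_of_abs_le (hFm.comp measurable_snd) fun z => abs_residual_mul_le hw z.2
  calc ENNReal.ofReal (∫ p, F p ∂(D : Measure Pair))
      ≤ ‖∫ z, (F z.1 - F z.2) ∂γ‖ₑ := by
        rw [e3, Real.enorm_eq_ofReal_abs]; exact ENNReal.ofReal_le_ofReal (le_abs_self _)
    _ ≤ ∫⁻ z, ‖F z.1 - F z.2‖ₑ ∂γ := enorm_integral_le_lintegral_enorm _
    _ ≤ ∫⁻ z, C * ρ z.1 z.2 ∂γ := lintegral_mono fun z => by
        rw [Real.enorm_eq_ofReal_abs]; exact hρ z.1 z.2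
    _ = C * ∫⁻ z, ρ z.1 z.2 ∂γ := lintegral_const_mul' _ _ hC

/-- Weak duality between test functions and the Wasserstein distance to calibration. -/
theorem ofReal_integral_residual_le_iInf {D : ProbabilityMeasure Pair}
    {w : unitInterval → ℝ} (hm : Measurable w)
    (hw : ∀ u, |w u| ≤ 1) {ρ : Pair → Pair → ℝ≥0∞} {C : ℝ≥0∞} (hC0 : C ≠ 0) (hC : C ≠ ∞)
    (hρ : ∀ p q : Pair, ENNReal.ofReal |(pred p - outcome p) * w p.1 -
      (pred q - outcome q) * w q.1| ≤ C * ρ p q) :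
    ENNReal.ofReal (∫ p, (pred p - outcome p) * w p.1 ∂(D : Measure Pair)) ≤
      C * ⨅ (D' : ProbabilityMeasure Pair) (_ : PerfectlyCalibrated D'), wasserstein ρ D D' := by
  rw [mul_comm, ← ENNReal.div_le_iff_le_mul (Or.inl hC0) (Or.inl hC)]
  refine le_iInf₂ fun D' hD' => ?_
  rw [ENNReal.div_le_iff_le_mul (Or.inl hC0) (Or.inl hC), mul_comm]
  exact ofReal_integral_residual_le hD' hm hw hC0 hC hρ

end WeakDuality

section Logit

theorem abs_sub_le_abs_logit_sub {a b : ℝ} (ha : 0 < a) (ha1 : a < 1) (hb : 0 < b)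
    (hb1 : b < 1) :
    |a - b| ≤ |Real.log (a / (1 - a)) - Real.log (b / (1 - b))| := by
  wlog hab : a ≤ b generalizing a b
  · rw [abs_sub_comm, abs_sub_comm (Real.log _)]
    exact this hb hb1 ha ha1 (le_of_not_ge hab)
  rw [abs_sub_comm, abs_sub_comm (Real.log _), abs_of_nonneg (sub_nonneg.2 hab)]
  refine le_trans ?_ (le_abs_self _)
  rw [Real.log_div hb.ne' (by linarith), Real.log_div ha.ne' (by linarith)]
  have h1 : Real.log (1 - b) ≤ Real.log (1 - a) := Real.log_le_log (by linarith) (by linarith)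
  have h2 : Real.log (a / b) ≤ a / b - 1 := Real.log_le_sub_one_of_pos (div_pos ha hb)
  rw [Real.log_div ha.ne' hb.ne'] at h2
  have h3 : a / b - 1 ≤ a - b := by
    rw [div_sub_one hb.ne', div_le_iff₀ hb]
    nlinarith
  linarith

theorem ofReal_abs_sub_le_dLogit (u v : unitInterval) :
    ENNReal.ofReal |(u : ℝ) - v| ≤ dLogit u v := by
  unfold dLogit
  split_ifs with h1 h2
  · simp [h1]
  · exact le_top
  · push Not at h2
    refine ENNReal.ofReal_le_ofReal (abs_sub_le_abs_logit_sub ?_ ?_ ?_ ?_)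
    · exact unitInterval.pos_iff_ne_zero.2 h2.1
    · exact unitInterval.lt_one_iff_ne_one.2 h2.2.1
    · exact unitInterval.pos_iff_ne_zero.2 h2.2.2.1
    · exact unitInterval.lt_one_iff_ne_one.2 h2.2.2.2

theorem abs_log_sub_log_le {r a b : ℝ} (hr : 0 < r) (ha : r ≤ a) (hb : r ≤ b) :
    |Real.log a - Real.log b| ≤ |a - b| / r := by
  wlog hab : a ≤ b generalizing a b
  · rw [abs_sub_comm, abs_sub_comm a]
    exact this hb ha (le_of_not_ge hab)
  have ha0 : 0 < a := hr.trans_le ha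
  have hb0 : 0 < b := hr.trans_le hb
  rw [abs_sub_comm, abs_sub_comm a, abs_of_nonneg (sub_nonneg.2 hab),
    abs_of_nonneg (sub_nonneg.2 (Real.log_le_log ha0 hab)), ← Real.log_div hb0.ne' ha0.ne']
  refine (Real.log_le_sub_one_of_pos (div_pos hb0 ha0)).trans ?_
  rw [div_sub_one ha0.ne']
  exact div_le_div_of_nonneg_left (sub_nonneg.2 hab) hr ha

theorem dLogit_le {r : ℝ} (hr : 0 < r) {u v : unitInterval} (hu : r ≤ u) (hu1 : (u : ℝ) ≤ 1 - r)
    (hv : r ≤ v) (hv1 : (v : ℝ) ≤ 1 - r) :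
    dLogit u v ≤ ENNReal.ofReal (2 * (|(u : ℝ) - v| / r)) := by
  have hne : ¬(u = 0 ∨ u = 1 ∨ v = 0 ∨ v = 1) := by
    rintro (rfl | rfl | rfl | rfl) <;> simp at hu hu1 hv hv1 <;> linarith
  unfold dLogit
  rw [if_neg hne]
  split_ifs
  · exact zero_le
  · refine ENNReal.ofReal_le_ofReal ?_
    rw [Real.log_div (by linarith) (by linarith), Real.log_div (by linarith) (by linarith)]
    have h1 := abs_log_sub_log_le hr hu hv
    have h2 := abs_log_sub_log_le (a := 1 - u) (b := 1 - v) hr (by linarith) (by linarith)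
    have h3 : |(1 - (u : ℝ)) - (1 - v)| = |(u : ℝ) - v| := by
      rw [abs_sub_comm]; congr 1; ring
    rw [h3] at h2
    rw [abs_le] at h1 h2 ⊢
    constructor <;> linarith

theorem abs_le_of_mem_testFunctions {d : unitInterval → unitInterval → ℝ≥0∞}
    {w : unitInterval → ℝ} (hw : w ∈ testFunctions d) (u : unitInterval) : |w u| ≤ 1 :=
  abs_le.2 (hw.1 u)

theorem measurable_of_mem_testFunctions {w : unitInterval → ℝ}
    (hw : w ∈ testFunctions dLogit) : Measurable w := by
  classical
  have hc : ContinuousOn w {u | 0 < u ∧ u < 1} := by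
    intro u hu
    have hlog : ContinuousAt (fun v : unitInterval => Real.log ((v : ℝ) / (1 - v))) u := by
      have h0 : (0 : ℝ) < u := hu.1
      have h1 : (u : ℝ) < 1 := hu.2
      refine ContinuousAt.log (ContinuousAt.div ?_ ?_ ?_) ?_
      · fun_prop
      · fun_prop
      · linarith
      · exact (div_pos h0 (by linarith)).ne'
    rw [ContinuousWithinAt, tendsto_iff_dist_tendsto_zero]
    have hl := (tendsto_iff_dist_tendsto_zero.1 hlog.tendsto).mono_left
      (nhdsWithin_le_nhds (s := {u | 0 < u ∧ u < 1}))
    refine squeeze_zero' (Filter.Eventually.of_forall fun _ => dist_nonneg) ?_ hl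
    filter_upwards [self_mem_nhdsWithin] with v hv
    have h := hw.2 v u
    unfold dLogit at h
    have hne : ¬(v = 0 ∨ v = 1 ∨ u = 0 ∨ u = 1) := by
      rintro (rfl | rfl | rfl | rfl)
      exacts [hv.1.ne rfl, hv.2.ne rfl, hu.1.ne rfl, hu.2.ne rfl]
    rw [if_neg hne] at h
    split_ifs at h with he
    · simp [he]
    · rw [Real.dist_eq, Real.dist_eq]
      exact (ENNReal.ofReal_le_ofReal_iff (abs_nonneg _)).1 h
  have hset : {u : unitInterval | 0 < u ∧ u < 1}ᶜ = {0, 1} := by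
    ext u
    simp only [Set.mem_compl_iff, Set.mem_ofPred_eq, Set.mem_insert_iff, Set.mem_singleton_iff,
      unitInterval.pos_iff_ne_zero, unitInterval.lt_one_iff_ne_one]
    tauto
  have h := ContinuousOn.measurable_piecewise (f := w) (g := w)
    (s := {u : unitInterval | 0 < u ∧ u < 1}) hc
    (by rw [hset]; exact (Set.toFinite _).continuousOn _)
    (isOpen_Ioo (a := (0 : unitInterval)) (b := 1)).measurableSet
  rwa [Set.piecewise_same] at h

theorem wCE_nonneg (d : unitInterval → unitInterval → ℝ≥0∞) (D : ProbabilityMeasure Pair) :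
    0 ≤ wCE d D :=
  le_csSup (wCE_wellDefined d D).2
    ⟨fun _ => 0, ⟨fun _ => by norm_num, fun _ _ => by simp⟩, by simp⟩

theorem ofReal_wCE_le_dCEOf (D : ProbabilityMeasure Pair) :
    ENNReal.ofReal (wCE dLogit D) ≤ 2 * dCEOf dLogit D := by
  have key : ∀ w ∈ testFunctions dLogit,
      ENNReal.ofReal (∫ p, (pred p - outcome p) * w p.1 ∂(D : Measure Pair)) ≤
        2 * dCEOf dLogit D := by
    intro w hw
    refine ofReal_integral_residual_le_iInf (measurable_of_mem_testFunctions hw)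
      (abs_le_of_mem_testFunctions hw) two_ne_zero ENNReal.ofNat_ne_top fun p q => ?_
    have e : |(pred p - outcome p) * w p.1 - (pred q - outcome q) * w q.1| ≤
        |pred p - pred q| + |outcome p - outcome q| + |w p.1 - w q.1| := by
      have e1 : (pred p - outcome p) * w p.1 - (pred q - outcome q) * w q.1 =
        ((pred p - pred q) - (outcome p - outcome q)) * w p.1 +
          (pred q - outcome q) * (w p.1 - w q.1) := by ring
      rw [e1]
      refine (abs_add_le _ _).trans (add_le_add ?_ ?_)
      · rw [abs_mul]
        exact (mul_le_of_le_one_right (abs_nonneg _) (abs_le_of_mem_testFunctions hw _)).trans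
          (abs_sub _ _)
      · rw [abs_mul]
        exact mul_le_of_le_one_left (abs_nonneg _) (abs_pred_sub_outcome_le q)
    refine (ENNReal.ofReal_le_ofReal e).trans ?_
    rw [ENNReal.ofReal_add (by positivity) (by positivity),
      ENNReal.ofReal_add (by positivity) (by positivity)]
    calc _ ≤ dLogit p.1 q.1 + ENNReal.ofReal |outcome p - outcome q| + dLogit p.1 q.1 :=
          add_le_add (add_le_add (ofReal_abs_sub_le_dLogit _ _) le_rfl) (hw.2 _ _)
      _ ≤ dLogit p.1 q.1 + ENNReal.ofReal |outcome p - outcome q| +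
          (dLogit p.1 q.1 + ENNReal.ofReal |outcome p - outcome q|) :=
          add_le_add le_rfl le_self_add
      _ = 2 * sumDist dLogit p q := by rw [two_mul]; rfl
  by_cases htop : dCEOf dLogit D = ∞
  · rw [htop, ENNReal.mul_top two_ne_zero]; exact le_top
  have hfin : 2 * dCEOf dLogit D ≠ ∞ := ENNReal.mul_ne_top ENNReal.ofNat_ne_top htop
  rw [ENNReal.ofReal_le_iff_le_toReal hfin]
  refine csSup_le (wCE_wellDefined _ D).1 ?_
  rintro _ ⟨w, hw, rfl⟩
  exact (ENNReal.ofReal_le_iff_le_toReal hfin).1 (key w hw)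

end Logit

section Hat

/-- The hat function of width `1 / N` around the node `k / N`. -/
def hat (N k : ℕ) (u : unitInterval) : ℝ := max 0 (1 - |N * (u : ℝ) - k|)

theorem hat_nonneg (N k : ℕ) (u : unitInterval) : 0 ≤ hat N k u := le_max_left _ _

theorem sum_range_hat {t : ℝ} (ht : 0 ≤ t) (N : ℕ) :
    ∑ k ∈ Finset.range (N + 1), max 0 (1 - |t - k|) = max 0 (min 1 (N + 1 - t)) := by
  induction N with
  | zero =>
    simp only [zero_add, Finset.sum_range_one, Nat.cast_zero, sub_zero, abs_of_nonneg ht]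
    rw [min_eq_right (by linarith)]
  | succ N ih =>
    rw [Finset.sum_range_succ, ih]
    push_cast
    rcases abs_cases (t - (N + 1)) with h | h <;>
    rcases max_cases (0 : ℝ) (1 - |t - (N + 1)|) with h1 | h1 <;>
    rcases min_cases (1 : ℝ) (N + 1 - t) with h2 | h2 <;>
    rcases max_cases (0 : ℝ) (min 1 (N + 1 - t)) with h3 | h3 <;>
    rcases min_cases (1 : ℝ) (N + 1 + 1 - t) with h4 | h4 <;>
    rcases max_cases (0 : ℝ) (min 1 (N + 1 + 1 - t)) with h5 | h5 <;>
    linarith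

theorem sum_hat (N : ℕ) (u : unitInterval) : ∑ k : Fin (N + 1), hat N k u = 1 := by
  have h0 : 0 ≤ (N : ℝ) * u := mul_nonneg N.cast_nonneg u.2.1
  have h1 : (N : ℝ) * u ≤ N := mul_le_of_le_one_right N.cast_nonneg u.2.2
  have h := sum_range_hat h0 N
  rw [min_eq_left (by linarith), max_eq_right zero_le_one] at h
  rw [← h, Finset.sum_range]
  rfl

theorem hat_le_one (N k : ℕ) (u : unitInterval) : hat N k u ≤ 1 :=
  max_le zero_le_one (by linarith [abs_nonneg (N * (u : ℝ) - k)])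

theorem abs_hat_sub_hat_le (N k : ℕ) (u v : unitInterval) :
    |hat N k u - hat N k v| ≤ N * |(u : ℝ) - v| := by
  have h1 : |hat N k u - hat N k v| ≤ |(1 - |N * (u : ℝ) - k|) - (1 - |N * (v : ℝ) - k|)| := by
    unfold hat
    rw [max_comm 0, max_comm 0]
    exact abs_max_sub_max_le_abs _ _ _
  have h2 : |(1 - |N * (u : ℝ) - k|) - (1 - |N * (v : ℝ) - k|)| ≤
      |(N * (v : ℝ) - k) - (N * (u : ℝ) - k)| := by
    have : (1 - |N * (u : ℝ) - k|) - (1 - |N * (v : ℝ) - k|) =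
      |N * (v : ℝ) - k| - |N * (u : ℝ) - k| := by ring
    rw [this]
    exact abs_abs_sub_abs_le _ _
  have h3 : |(N * (v : ℝ) - k) - (N * (u : ℝ) - k)| = N * |(u : ℝ) - v| := by
    rw [show (N * (v : ℝ) - k) - (N * (u : ℝ) - k) = N * (v - u) by ring, abs_mul,
      Nat.abs_cast, abs_sub_comm]
  linarith

theorem measurable_hat (N k : ℕ) : Measurable (hat N k) := by
  have : Continuous (hat N k) := by unfold hat; fun_prop
  exact this.measurable

theorem hat_eq_zero_or {N : ℕ} (hN : 0 < N) (k : ℕ) (u : unitInterval) :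
    hat N k u = 0 ∨ |(u : ℝ) - k / N| ≤ 1 / N := by
  have hN' : (0 : ℝ) < N := Nat.cast_pos.2 hN
  refine or_iff_not_imp_right.2 fun hu => max_eq_left ?_
  rw [not_le, div_lt_iff₀ hN'] at hu
  have : N * (u : ℝ) - k = ((u : ℝ) - k / N) * N := by field_simp
  rw [this, abs_mul, Nat.abs_cast]
  linarith

/-- The total bias over the soft buckets given by the hat functions. -/
def bucketError (N : ℕ) (D : ProbabilityMeasure Pair) : ℝ :=
  ∑ k : Fin (N + 1), |∫ p, (pred p - outcome p) * hat N k p.1 ∂(D : Measure Pair)|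

theorem exists_bucketError_eq (N : ℕ) (D : ProbabilityMeasure Pair) :
    ∃ w : unitInterval → ℝ, Measurable w ∧ (∀ u, |w u| ≤ 1) ∧
      (∀ u v : unitInterval, |w u - w v| ≤ (N + 1) * N * |(u : ℝ) - v|) ∧
      bucketError N D = ∫ p, (pred p - outcome p) * w p.1 ∂(D : Measure Pair) := by
  set e : Fin (N + 1) → ℝ := fun k =>
    ∫ p, (pred p - outcome p) * hat N k p.1 ∂(D : Measure Pair) with he
  have hs : ∀ k, |(SignType.sign (e k) : ℝ)| ≤ 1 := fun k => by
    rcases lt_trichotomy (e k) 0 with h | h | h <;> simp [h]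
  refine ⟨fun u => ∑ k : Fin (N + 1), (SignType.sign (e k) : ℝ) * hat N k u, ?_, ?_, ?_, ?_⟩
  · exact Finset.measurable_sum _ fun k _ => (measurable_hat N k).const_mul _
  · intro u
    refine (Finset.abs_sum_le_sum_abs _ _).trans ?_
    rw [← sum_hat N u]
    refine Finset.sum_le_sum fun k _ => ?_
    rw [abs_mul, abs_of_nonneg (hat_nonneg N k u)]
    exact mul_le_of_le_one_left (hat_nonneg _ _ _) (hs k)
  · intro u v
    rw [← Finset.sum_sub_distrib]
    refine (Finset.abs_sum_le_sum_abs _ _).trans ?_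
    calc _ ≤ ∑ k : Fin (N + 1), N * |(u : ℝ) - v| := by
          refine Finset.sum_le_sum fun k _ => ?_
          rw [← mul_sub, abs_mul]
          exact (mul_le_of_le_one_left (abs_nonneg _) (hs k)).trans (abs_hat_sub_hat_le N k u v)
      _ = (N + 1) * N * |(u : ℝ) - v| := by simp [mul_assoc]
  · have h1 : ∀ p : Pair, (pred p - outcome p) *
        ∑ k : Fin (N + 1), (SignType.sign (e k) : ℝ) * hat N k p.1 =
        ∑ k : Fin (N + 1), (SignType.sign (e k) : ℝ) * ((pred p - outcome p) * hat N k p.1) :=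
      fun p => by
        rw [Finset.mul_sum]
        exact Finset.sum_congr rfl fun k _ => by ring
    simp only [h1]
    rw [integral_finsetSum]
    · unfold bucketError
      refine Finset.sum_congr rfl fun k _ => ?_
      rw [integral_const_mul]
      exact (sign_mul_self (e k)).symm
    · intro k _
      exact (integrable_residual_mul D (measurable_hat N k) fun u => by
        rw [abs_of_nonneg (hat_nonneg _ _ _)]; exact hat_le_one _ _ _).const_mul _

theorem bucketError_nonneg (N : ℕ) (D : ProbabilityMeasure Pair) : 0 ≤ bucketError N D :=
  Finset.sum_nonneg fun _ _ => abs_nonneg _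

theorem bucketError_le_one (N : ℕ) (D : ProbabilityMeasure Pair) : bucketError N D ≤ 1 := by
  obtain ⟨w, hm, hw, -, h⟩ := exists_bucketError_eq N D
  rw [h]
  have := norm_integral_le_of_norm_le_const (μ := (D : Measure Pair)) (C := 1)
    (f := fun p => (pred p - outcome p) * w p.1)
    (Filter.Eventually.of_forall fun p => abs_residual_mul_le hw p)
  simp only [probReal_univ, mul_one] at this
  exact (le_abs_self _).trans this

theorem bucketError_le_wCE {N : ℕ} (hN : 0 < N) (D : ProbabilityMeasure Pair) :
    bucketError N D ≤ 2 * N ^ 2 * wCE dLogit D := by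
  obtain ⟨w, hm, hw, hL, h⟩ := exists_bucketError_eq N D
  have hN' : (1 : ℝ) ≤ N := Nat.one_le_cast.2 hN
  set L : ℝ := (N + 1) * N with hLdef
  have hL1 : 1 ≤ L := by nlinarith
  have hmem : (fun u => L⁻¹ * w u) ∈ testFunctions dLogit := by
    constructor
    · intro u
      rw [Set.mem_Icc, ← abs_le, abs_mul, abs_of_nonneg (by positivity)]
      exact mul_le_one₀ (inv_le_one_of_one_le₀ hL1) (abs_nonneg _) (hw u)
    · intro u v
      refine le_trans (ENNReal.ofReal_le_ofReal ?_) (ofReal_abs_sub_le_dLogit u v)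
      rw [← mul_sub, abs_mul, abs_of_nonneg (by positivity : 0 ≤ L⁻¹),
        inv_mul_le_iff₀ (by linarith)]
      exact hL u v
  have h1 := le_csSup (wCE_wellDefined dLogit D).2 ⟨_, hmem, rfl⟩
  have h2 : ∫ p, (pred p - outcome p) * (L⁻¹ * w p.1) ∂(D : Measure Pair) =
      L⁻¹ * bucketError N D := by
    rw [h, ← integral_const_mul]
    congr 1 with p
    ring
  change ∫ p, (pred p - outcome p) * (L⁻¹ * w p.1) ∂(D : Measure Pair) ≤ wCE dLogit D at h1
  rw [h2, inv_mul_le_iff₀ (by linarith)] at h1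
  refine h1.trans (mul_le_mul_of_nonneg_right ?_ (wCE_nonneg _ _))
  nlinarith

theorem bucketError_le_dCE {N : ℕ} (hN : 0 < N) (D : ProbabilityMeasure Pair) :
    ENNReal.ofReal (bucketError N D) ≤ ENNReal.ofReal (3 * N ^ 2) * dCE D := by
  obtain ⟨w, hm, hw, hL, h⟩ := exists_bucketError_eq N D
  have hN' : (1 : ℝ) ≤ N := Nat.one_le_cast.2 hN
  have hpos : (0 : ℝ) < 3 * N ^ 2 := by positivity
  rw [h]
  refine ofReal_integral_residual_le_iInf hm hw (ENNReal.ofReal_pos.2 hpos).ne'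
    ENNReal.ofReal_ne_top fun p q => ?_
  unfold splitDist
  split_ifs with hpq
  · rw [← ENNReal.ofReal_mul hpos.le]
    refine ENNReal.ofReal_le_ofReal ?_
    have ho : outcome p = outcome q := by unfold outcome; rw [hpq]
    have e1 : (pred p - outcome p) * w p.1 - (pred q - outcome q) * w q.1 =
        (pred p - pred q) * w p.1 + (pred q - outcome q) * (w p.1 - w q.1) := by
      rw [ho]; ring
    have e2 : |(pred p - pred q) * w p.1| ≤ |pred p - pred q| := by
      rw [abs_mul]; exact mul_le_of_le_one_right (abs_nonneg _) (hw _)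
    have e3 : |(pred q - outcome q) * (w p.1 - w q.1)| ≤ (N + 1) * N * |pred p - pred q| := by
      rw [abs_mul]
      exact (mul_le_of_le_one_left (abs_nonneg _) (abs_pred_sub_outcome_le q)).trans (hL _ _)
    rw [e1]
    refine (abs_add_le _ _).trans ((add_le_add e2 e3).trans ?_)
    have : (1 : ℝ) + (N + 1) * N ≤ 3 * N ^ 2 := by nlinarith
    nlinarith [mul_le_mul_of_nonneg_right this (abs_nonneg (pred p - pred q))]
  · rw [ENNReal.mul_top (ENNReal.ofReal_pos.2 hpos).ne']
    exact le_top

end Hat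

section Transport

/-- Moving a fraction `φ k` of the mass at each point to prediction `t k`, with outcome `1`
with probability `q k`. -/
theorem exists_calibrated_wasserstein_le {ι : Type*} [Fintype ι] (D : ProbabilityMeasure Pair)
    {φ q : ι → Pair → ℝ} {t : ι → Pair → unitInterval}
    (hφm : ∀ k, Measurable (φ k)) (hqm : ∀ k, Measurable (q k)) (htm : ∀ k, Measurable (t k))
    (hφ0 : ∀ k p, 0 ≤ φ k p) (hφ1 : ∀ p, ∑ k, φ k p = 1)
    (hq0 : ∀ k p, 0 ≤ q k p) (hq1 : ∀ k p, q k p ≤ 1)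
    (hcal : ∀ k, ∀ S : Set unitInterval, MeasurableSet S →
      ∫ p in t k ⁻¹' S, φ k p * (t k p - q k p) ∂(D : Measure Pair) = 0) :
    ∃ D' : ProbabilityMeasure Pair, PerfectlyCalibrated D' ∧
      ∀ (ρ : Pair → Pair → ℝ≥0∞) (R : ι → Bool → Pair → ℝ),
        (∀ k b, Integrable (R k b) (D : Measure Pair)) →
        (∀ k b p, 0 ≤ R k b p) →
        (∀ k p, ENNReal.ofReal (φ k p * q k p) * ρ p (t k p, true) ≤
          ENNReal.ofReal (R k true p)) →
        (∀ k p, ENNReal.ofReal (φ k p * (1 - q k p)) * ρ p (t k p, false) ≤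
          ENNReal.ofReal (R k false p)) →
        wasserstein ρ D D' ≤
          ENNReal.ofReal (∑ k, (∫ p, R k true p ∂(D : Measure Pair) +
            ∫ p, R k false p ∂(D : Measure Pair))) := by
  set ψ : ι × Bool → Pair → ℝ := fun j p =>
    φ j.1 p * (if j.2 then q j.1 p else 1 - q j.1 p) with hψ
  have hψm : ∀ j, Measurable (ψ j) := by
    rintro ⟨k, b⟩
    cases b
    · exact (hφm k).mul (measurable_const.sub (hqm k))
    · exact (hφm k).mul (hqm k)
  have hψ0 : ∀ j p, 0 ≤ ψ j p := by
    rintro ⟨k, b⟩ p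
    refine mul_nonneg (hφ0 k p) ?_
    dsimp only
    split_ifs
    exacts [hq0 k p, sub_nonneg.2 (hq1 k p)]
  have hψ1 : ∀ p, ∑ j, ψ j p = 1 := fun p => by
    rw [Fintype.sum_prod_type, ← hφ1 p]
    refine Finset.sum_congr rfl fun k _ => ?_
    simp [hψ]
    ring
  have hψle : ∀ j p, |ψ j p| ≤ 1 := fun j p => by
    rw [abs_of_nonneg (hψ0 j p), ← hψ1 p]
    exact Finset.single_le_sum (fun i _ => hψ0 i p) (Finset.mem_univ j)
  set T : ι × Bool → Pair → Pair := fun j p => (t j.1 p, j.2) with hT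
  have hTm : ∀ j, Measurable (T j) := fun j => (htm j.1).prodMk measurable_const
  set μ : ι × Bool → Measure Pair := fun j =>
    (D : Measure Pair).withDensity fun p => ENNReal.ofReal (ψ j p) with hμ
  have hμsum : ∑ j, μ j = (D : Measure Pair) := by
    ext S hS
    rw [Measure.finsetSum_apply]
    simp only [hμ, withDensity_apply _ hS]
    rw [← lintegral_finsetSum _ fun j _ => (hψm j).ennreal_ofReal]
    simp only [← ENNReal.ofReal_sum_of_nonneg fun j _ => hψ0 j _, hψ1]
    simp
  have hμfin : ∀ j, IsFiniteMeasure (μ j) := fun j => by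
    refine ⟨lt_of_le_of_lt ?_ (measure_lt_top (D : Measure Pair) Set.univ)⟩
    rw [← hμsum, Measure.finsetSum_apply]
    exact Finset.single_le_sum (f := fun i => μ i Set.univ) (fun i _ => zero_le)
      (Finset.mem_univ j)
  have hpm : IsProbabilityMeasure (∑ j, (μ j).map (T j)) := by
    constructor
    rw [Measure.finsetSum_apply]
    simp only [Measure.map_apply (hTm _) MeasurableSet.univ, Set.preimage_univ]
    rw [← Measure.finsetSum_apply, hμsum, measure_univ]
  refine ⟨⟨∑ j, (μ j).map (T j), hpm⟩, ?_, ?_⟩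
  · refine perfectlyCalibrated_of_setIntegral fun S hS => ?_
    have hS' : MeasurableSet (Prod.fst ⁻¹' S : Set Pair) := measurable_fst hS
    have hTS : ∀ j : ι × Bool, MeasurableSet (t j.1 ⁻¹' S) := fun j => htm j.1 hS
    have hset : ∀ g : Pair → ℝ, Measurable g → (∀ p, |g p| ≤ 1) →
        ∫ p in Prod.fst ⁻¹' S, g p ∂(∑ j, (μ j).map (T j)) =
          ∑ j : ι × Bool, ∫ p in t j.1 ⁻¹' S, ψ j p * g (T j p) ∂(D : Measure Pair) := by
      intro g hg hg1
      rw [← integral_indicator hS', integral_finsetSum_measure]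
      · refine Finset.sum_congr rfl fun j _ => ?_
        rw [integral_map (hTm j).aemeasurable (hg.indicator hS').aestronglyMeasurable]
        simp only [hμ]
        rw [integral_withDensity_eq_integral_toReal_smul (hψm j).ennreal_ofReal
          (Filter.Eventually.of_forall fun _ => ENNReal.ofReal_lt_top),
          ← integral_indicator (hTS j)]
        congr 1 with p
        rw [ENNReal.toReal_ofReal (hψ0 j p)]
        by_cases hp : t j.1 p ∈ S <;> simp [Set.indicator, hT, hp]
      · intro j _
        exact (integrable_of_abs_le (hg.indicator hS') (C := 1) fun p => by
          by_cases hp : p.1 ∈ S <;> simp [Set.indicator, hp, hg1])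
    change ∫ p in Prod.fst ⁻¹' S, pred p ∂(∑ j, (μ j).map (T j)) =
      ∫ p in Prod.fst ⁻¹' S, outcome p ∂(∑ j, (μ j).map (T j))
    rw [hset pred measurable_pred abs_pred_le_one, hset outcome measurable_outcome abs_outcome_le_one, ← sub_eq_zero,
      ← Finset.sum_sub_distrib, Fintype.sum_prod_type]
    refine Finset.sum_eq_zero fun k _ => ?_
    have hi : ∀ (g : Pair → ℝ) (b : Bool), Measurable g → (∀ p, |g p| ≤ 1) →
        IntegrableOn (fun p => ψ (k, b) p * g (T (k, b) p)) (t k ⁻¹' S) (D : Measure Pair) :=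
      fun g b hg hg1 => (integrable_of_abs_le ((hψm _).mul (hg.comp (hTm _))) (C := 1)
        fun p => by
          rw [Pi.mul_apply, abs_mul]
          exact mul_le_one₀ (hψle _ _) (abs_nonneg _) (hg1 _)).integrableOn
    have hd : ∀ b, IntegrableOn (fun p => ψ (k, b) p * pred (T (k, b) p) -
        ψ (k, b) p * outcome (T (k, b) p)) (t k ⁻¹' S) (D : Measure Pair) := fun b =>
      (hi _ b measurable_pred abs_pred_le_one).sub (hi _ b measurable_outcome abs_outcome_le_one)
    simp only [← integral_sub (hi _ _ measurable_pred abs_pred_le_one)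
      (hi _ _ measurable_outcome abs_outcome_le_one)]
    rw [Fintype.sum_bool, ← integral_add (hd true) (hd false), ← hcal k S hS]
    congr 1 with p
    simp [hψ, hT, pred, outcome]
    ring
  · intro ρ R hR hR0 h1 h2
    have hg : ∀ j, Measurable fun p : Pair => (p, T j p) := fun j => measurable_id.prodMk (hTm j)
    have hγ : IsCoupling D ⟨∑ j, (μ j).map (T j), hpm⟩
        (∑ j, (μ j).map fun p => (p, T j p)) := by
      constructor
      · rw [Measure.map_finset_sum measurable_fst.aemeasurable]
        simp only [Measure.map_map measurable_fst (hg _), Function.comp_def, Measure.map_id']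
        exact hμsum
      · rw [Measure.map_finset_sum measurable_snd.aemeasurable]
        simp only [Measure.map_map measurable_snd (hg _), Function.comp_def]
        rfl
    refine (iInf₂_le _ hγ).trans ?_
    · have hb : ∀ k b, ∫⁻ z, ρ z.1 z.2 ∂((μ (k, b)).map fun p => (p, T (k, b) p)) ≤
          ENNReal.ofReal (∫ p, R k b p ∂(D : Measure Pair)) := fun k b => by
        rw [ofReal_integral_eq_lintegral_ofReal (hR k b) (Filter.Eventually.of_forall (hR0 k b))]
        refine (lintegral_map_le _ _).trans
          ((lintegral_withDensity_le_lintegral_mul _ (hψm _).ennreal_ofReal _).trans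
            (lintegral_mono fun p => ?_))
        cases b
        · simpa [hψ, hT] using h2 k p
        · simpa [hψ, hT] using h1 k p
      have hi0 : ∀ k b, 0 ≤ ∫ p, R k b p ∂(D : Measure Pair) :=
        fun k b => integral_nonneg (hR0 k b)
      rw [lintegral_finsetSum_measure, Fintype.sum_prod_type,
        ENNReal.ofReal_sum_of_nonneg fun k _ => add_nonneg (hi0 k _) (hi0 k _)]
      refine Finset.sum_le_sum fun k _ => ?_
      rw [Fintype.sum_bool, ENNReal.ofReal_add (hi0 k _) (hi0 k _)]
      exact add_le_add (hb k true) (hb k false)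

end Transport

section Buckets

/-- The node `k / N` of the grid. -/
def node (N : ℕ) (k : Fin (N + 1)) : unitInterval :=
  ⟨k / N, by positivity,
    div_le_one_of_le₀ (Nat.cast_le.2 (Nat.lt_succ_iff.1 k.2)) N.cast_nonneg⟩

theorem integrable_hat_mul (D : ProbabilityMeasure Pair) (N k : ℕ) {g : Pair → ℝ}
    (hg : Measurable g) {C : ℝ} (hC : ∀ p, |g p| ≤ C) :
    Integrable (fun p => hat N k p.1 * g p) (D : Measure Pair) :=
  integrable_of_abs_le (((measurable_hat N k).comp measurable_fst).mul hg) fun p => by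
    rw [abs_mul, abs_of_nonneg (hat_nonneg _ _ _)]
    exact (mul_le_of_le_one_left (abs_nonneg _) (hat_le_one _ _ _)).trans (hC p)

theorem integrable_hat (D : ProbabilityMeasure Pair) (N k : ℕ) :
    Integrable (fun p : Pair => hat N k p.1) (D : Measure Pair) :=
  integrable_of_abs_le ((measurable_hat N k).comp measurable_fst) (C := 1) fun p => by
    rw [abs_of_nonneg (hat_nonneg _ _ _)]
    exact hat_le_one _ _ _

/-- The mass of a soft bucket. -/
def mass (D : ProbabilityMeasure Pair) (N k : ℕ) : ℝ :=
  ∫ p, hat N k p.1 ∂(D : Measure Pair)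

/-- The mass of outcome `1` in a soft bucket. -/
def massOne (D : ProbabilityMeasure Pair) (N k : ℕ) : ℝ :=
  ∫ p, hat N k p.1 * outcome p ∂(D : Measure Pair)

/-- The signed bias of a soft bucket. -/
def bias (D : ProbabilityMeasure Pair) (N k : ℕ) : ℝ :=
  ∫ p, (pred p - outcome p) * hat N k p.1 ∂(D : Measure Pair)

theorem mass_nonneg (D : ProbabilityMeasure Pair) (N k : ℕ) : 0 ≤ mass D N k :=
  integral_nonneg fun _ => hat_nonneg _ _ _

theorem massOne_nonneg (D : ProbabilityMeasure Pair) (N k : ℕ) : 0 ≤ massOne D N k :=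
  integral_nonneg fun p => mul_nonneg (hat_nonneg _ _ _) (outcome_nonneg p)

theorem massOne_le_mass (D : ProbabilityMeasure Pair) (N k : ℕ) : massOne D N k ≤ mass D N k :=
  integral_mono (integrable_hat_mul D N k measurable_outcome abs_outcome_le_one)
    (integrable_hat D N k) fun p => mul_le_of_le_one_right (hat_nonneg _ _ _) (outcome_le_one p)

theorem sum_mass (D : ProbabilityMeasure Pair) (N : ℕ) :
    ∑ k : Fin (N + 1), mass D N k = 1 := by
  unfold mass
  rw [← integral_finsetSum (f := fun (k : Fin (N + 1)) (p : Pair) => hat N k p.1) _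
    fun k _ => integrable_hat D N k]
  simp only [sum_hat]
  simp

/-- Integral over a soft bucket of an affine function of the outcome. -/
theorem integral_hat_mul_affine (D : ProbabilityMeasure Pair) (N k : ℕ) (a b : ℝ) :
    ∫ p, hat N k p.1 * (a * outcome p + b * (1 - outcome p)) ∂(D : Measure Pair) =
      a * massOne D N k + b * (mass D N k - massOne D N k) := by
  have h : ∀ p : Pair, hat N k p.1 * (a * outcome p + b * (1 - outcome p)) =
      (a - b) * (hat N k p.1 * outcome p) + b * hat N k p.1 := fun p => by ring
  simp only [h]
  rw [integral_add ((integrable_hat_mul D N k measurable_outcome abs_outcome_le_one).const_mul _)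
    ((integrable_hat D N k).const_mul _), integral_const_mul, integral_const_mul]
  unfold mass massOne
  ring

theorem bias_eq (D : ProbabilityMeasure Pair) (N k : ℕ) :
    bias D N k = ∫ p, hat N k p.1 * pred p ∂(D : Measure Pair) - massOne D N k := by
  unfold bias massOne
  rw [← integral_sub (integrable_hat_mul D N k measurable_pred abs_pred_le_one)
    (integrable_hat_mul D N k measurable_outcome abs_outcome_le_one)]
  congr 1 with p
  ring

theorem integral_hat_mul_pred_le (D : ProbabilityMeasure Pair) {N k : ℕ} {c : ℝ}
    (h : ∀ u : unitInterval, hat N k u = 0 ∨ (u : ℝ) ≤ c) :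
    ∫ p, hat N k p.1 * pred p ∂(D : Measure Pair) ≤ c * mass D N k := by
  unfold mass
  rw [← integral_const_mul]
  refine integral_mono (integrable_hat_mul D N k measurable_pred abs_pred_le_one)
    ((integrable_hat D N k).const_mul _) fun p => ?_
  rcases h p.1 with h | h
  · simp [h]
  · dsimp only
    rw [mul_comm]
    exact mul_le_mul_of_nonneg_right h (hat_nonneg _ _ _)

theorem le_integral_hat_mul_pred (D : ProbabilityMeasure Pair) {N k : ℕ} {c : ℝ}
    (h : ∀ u : unitInterval, hat N k u = 0 ∨ c ≤ (u : ℝ)) :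
    c * mass D N k ≤ ∫ p, hat N k p.1 * pred p ∂(D : Measure Pair) := by
  unfold mass
  rw [← integral_const_mul]
  refine integral_mono ((integrable_hat D N k).const_mul _)
    (integrable_hat_mul D N k measurable_pred abs_pred_le_one) fun p => ?_
  rcases h p.1 with h | h
  · simp [h]
  · dsimp only
    rw [mul_comm]
    exact mul_le_mul_of_nonneg_left h (hat_nonneg _ _ _)

theorem abs_massOne_sub_le (D : ProbabilityMeasure Pair) {N : ℕ} (hN : 0 < N) (k : ℕ) :
    |massOne D N k - k / N * mass D N k| ≤ |bias D N k| + 1 / N * mass D N k := by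
  have h1 := integral_hat_mul_pred_le D (N := N) (k := k) (c := k / N + 1 / N) fun u =>
    (hat_eq_zero_or hN k u).imp_right fun h => by linarith [(abs_le.1 h).2]
  have h2 := le_integral_hat_mul_pred D (N := N) (k := k) (c := k / N - 1 / N) fun u =>
    (hat_eq_zero_or hN k u).imp_right fun h => by linarith [(abs_le.1 h).1]
  have h3 := bias_eq D N k
  have h4 := neg_abs_le (bias D N k)
  have h5 := le_abs_self (bias D N k)
  rw [abs_le]
  constructor <;> linarith

theorem setIntegral_preimage_const_eq_zero (D : ProbabilityMeasure Pair) {c : unitInterval}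
    {f : Pair → ℝ} (h : ∫ p, f p ∂(D : Measure Pair) = 0) (S : Set unitInterval) :
    ∫ p in (fun _ : Pair => c) ⁻¹' S, f p ∂(D : Measure Pair) = 0 := by
  by_cases hc : c ∈ S
  · rw [Set.preimage_const_of_mem hc, Measure.restrict_univ, h]
  · rw [Set.preimage_const_of_notMem hc, Measure.restrict_empty, integral_zero_measure]

end Buckets

section SplitBound

theorem dCE_le {N : ℕ} (hN : 0 < N) (D : ProbabilityMeasure Pair) :
    dCE D ≤ ENNReal.ofReal (2 / N + bucketError N D) := by
  have hg : ∀ k : Fin (N + 1), ∃ g : unitInterval, (g : ℝ) * mass D N k = massOne D N k := by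
    intro k
    refine ⟨⟨massOne D N k / mass D N k, div_nonneg (massOne_nonneg _ _ _) (mass_nonneg _ _ _),
      div_le_one_of_le₀ (massOne_le_mass _ _ _) (mass_nonneg _ _ _)⟩, ?_⟩
    rcases (mass_nonneg D N k).eq_or_lt with h | h
    · change massOne D N k / mass D N k * mass D N k = massOne D N k
      rw [← h, mul_zero]
      exact le_antisymm (massOne_nonneg _ _ _) (h ▸ massOne_le_mass D N k)
    · exact div_mul_cancel₀ _ h.ne'
  choose g hg using hg
  obtain ⟨D', hD', h⟩ := exists_calibrated_wasserstein_le D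
    (φ := fun k : Fin (N + 1) => fun p => hat N k p.1) (q := fun _ => outcome)
    (t := fun k _ => g k)
    (fun k => (measurable_hat N k).comp measurable_fst) (fun _ => measurable_outcome)
    (fun _ => measurable_const) (fun k p => hat_nonneg _ _ _) (fun p => sum_hat N p.1)
    (fun _ => outcome_nonneg) (fun _ => outcome_le_one) (by
      intro k S _
      refine setIntegral_preimage_const_eq_zero D ?_ S
      have e : ∀ p : Pair, hat N k p.1 * ((g k : ℝ) - outcome p) =
        hat N k p.1 * (((g k : ℝ) - 1) * outcome p + g k * (1 - outcome p)) := fun p => by ring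
      simp only [e]
      rw [integral_hat_mul_affine]
      linarith [hg k])
  set r : Fin (N + 1) → ℝ := fun k => 1 / N + |(k : ℝ) / N - g k| with hr
  have hr0 : ∀ k, 0 ≤ r k := fun k => by positivity
  have hdist : ∀ (k : Fin (N + 1)) (p : Pair), hat N k p.1 = 0 ∨ |pred p - g k| ≤ r k :=
    fun k p => (hat_eq_zero_or hN k p.1).imp_right fun h =>
      (abs_sub_le _ ((k : ℝ) / N) _).trans (add_le_add h le_rfl)
  have hW := h splitDist
    (fun k b p => hat N k p.1 * ((if b then r k else 0) * outcome p +
      (if b then 0 else r k) * (1 - outcome p))) ?_ ?_ ?_ ?_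
  · refine (iInf₂_le D' hD').trans (hW.trans (ENNReal.ofReal_le_ofReal ?_))
    calc _ = ∑ k : Fin (N + 1), r k * mass D N k := by
          refine Finset.sum_congr rfl fun k _ => ?_
          rw [integral_hat_mul_affine, integral_hat_mul_affine]
          simp only [if_true, Bool.false_eq_true, if_false]
          ring
      _ ≤ ∑ k : Fin (N + 1), (2 / N * mass D N k + |bias D N k|) := by
          refine Finset.sum_le_sum fun k _ => ?_
          have h1 := abs_massOne_sub_le D hN k
          rw [← hg k, ← sub_mul, abs_mul, abs_of_nonneg (mass_nonneg D N k), abs_sub_comm] at h1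
          rw [hr]
          dsimp only
          rw [add_mul, show (2 : ℝ) / N = 1 / N + 1 / N by ring]
          linarith
      _ = 2 / N + bucketError N D := by
          rw [Finset.sum_add_distrib, ← Finset.mul_sum, sum_mass, mul_one]
          rfl
  · intro k b
    refine integrable_hat_mul D N k ((measurable_outcome.const_mul _).add
      ((measurable_const.sub measurable_outcome).const_mul _)) (C := r k) fun p => ?_
    cases b
    · simp only [Bool.false_eq_true, if_false, zero_mul, zero_add]
      rw [abs_of_nonneg (mul_nonneg (hr0 k) (sub_nonneg.2 (outcome_le_one p)))]
      exact mul_le_of_le_one_right (hr0 k) (by linarith [outcome_nonneg p])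
    · simp only [if_true, zero_mul, add_zero]
      rw [abs_of_nonneg (mul_nonneg (hr0 k) (outcome_nonneg p))]
      exact mul_le_of_le_one_right (hr0 k) (outcome_le_one p)
  · intro k b p
    have h1 := outcome_nonneg p
    have h2 : 0 ≤ 1 - outcome p := sub_nonneg.2 (outcome_le_one p)
    have h3 := hr0 k
    exact mul_nonneg (hat_nonneg _ _ _) (by split_ifs <;> positivity)
  · rintro k ⟨u, b⟩
    rcases hdist k (u, b) with h0 | h0
    · dsimp only at h0
      simp [h0]
    · cases b
      · simp [outcome]
      · simp only [outcome, if_true, mul_one, sub_self, mul_zero, add_zero, splitDist]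
        rw [ENNReal.ofReal_mul (hat_nonneg _ _ _)]
        exact mul_le_mul_right (ENNReal.ofReal_le_ofReal h0) _
  · rintro k ⟨u, b⟩
    rcases hdist k (u, b) with h0 | h0
    · dsimp only at h0
      simp [h0]
    · cases b
      · simp only [outcome, Bool.false_eq_true, if_true, if_false, mul_one, sub_zero, mul_zero,
          zero_add, splitDist]
        rw [ENNReal.ofReal_mul (hat_nonneg _ _ _)]
        exact mul_le_mul_right (ENNReal.ofReal_le_ofReal h0) _
      · simp [outcome]

end SplitBound

section LogitBound

/-- Optimal relabelling of a bucket with mass `m`, of which `a` has outcome `1`, so that the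
mean outcome becomes `c`. -/
theorem exists_relabelling {a m c : ℝ} (ha : 0 ≤ a) (ham : a ≤ m) (hc : 0 ≤ c) (hc1 : c ≤ 1) :
    ∃ q0 q1 : ℝ, 0 ≤ q0 ∧ q0 ≤ 1 ∧ 0 ≤ q1 ∧ q1 ≤ 1 ∧ q1 * a + q0 * (m - a) = c * m ∧
      (1 - q1) * a + q0 * (m - a) = |a - c * m| := by
  have hm : 0 ≤ m := ha.trans ham
  rcases le_or_gt (c * m) a with h | h
  · refine ⟨0, c * m / a, le_rfl, zero_le_one, div_nonneg (mul_nonneg hc hm) ha,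
      div_le_one_of_le₀ h ha, ?_⟩
    rw [abs_of_nonneg (sub_nonneg.2 h)]
    rcases ha.eq_or_lt with h0 | h0
    · have : c * m = 0 := le_antisymm (by linarith) (mul_nonneg hc hm)
      rw [this, ← h0]
      simp
    · have : c * m / a * a = c * m := div_mul_cancel₀ _ h0.ne'
      constructor <;> linarith
  · have hcm : c * m ≤ m := mul_le_of_le_one_left hm hc1
    have hd : 0 < m - a := by linarith
    have : (c * m - a) / (m - a) * (m - a) = c * m - a := div_mul_cancel₀ _ hd.ne'
    refine ⟨(c * m - a) / (m - a), 1, div_nonneg (by linarith) hd.le,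
      div_le_one_of_le₀ (by linarith) hd.le, zero_le_one, le_rfl, by linarith, ?_⟩
    rw [abs_of_neg (by linarith)]
    linarith

theorem sumDist_dLogit_self (p : Pair) (b : Bool) :
    sumDist dLogit p (p.1, b) = ENNReal.ofReal |outcome p - if b then 1 else 0| := by
  simp [sumDist, dLogit, outcome]

/-- The data needed to move a soft bucket at small cost to a calibrated distribution. -/
theorem exists_bucket_transport {M : ℕ} (hM : 0 < M) (D : ProbabilityMeasure Pair)
    (k : Fin (M ^ 2 + 1)) :
    ∃ (q : Pair → ℝ) (t : Pair → unitInterval) (R : Bool → Pair → ℝ),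
      Measurable q ∧ Measurable t ∧ (∀ p, 0 ≤ q p) ∧ (∀ p, q p ≤ 1) ∧
      (∀ S : Set unitInterval, MeasurableSet S →
        ∫ p in t ⁻¹' S, hat (M ^ 2) k p.1 * (t p - q p) ∂(D : Measure Pair) = 0) ∧
      (∀ b, Integrable (R b) (D : Measure Pair)) ∧ (∀ b p, 0 ≤ R b p) ∧
      (∀ p, ENNReal.ofReal (hat (M ^ 2) k p.1 * q p) * sumDist dLogit p (t p, true) ≤
        ENNReal.ofReal (R true p)) ∧
      (∀ p, ENNReal.ofReal (hat (M ^ 2) k p.1 * (1 - q p)) * sumDist dLogit p (t p, false) ≤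
        ENNReal.ofReal (R false p)) ∧
      ∫ p, R true p ∂(D : Measure Pair) + ∫ p, R false p ∂(D : Measure Pair) ≤
        4 / M * mass D (M ^ 2) k + |bias D (M ^ 2) k| := by
  have hM' : (1 : ℝ) ≤ M := Nat.one_le_cast.2 hM
  have hN : 0 < M ^ 2 := by positivity
  have hm := mass_nonneg D (M ^ 2) k
  have hab := le_abs_self (bias D (M ^ 2) k)
  have hab' := neg_abs_le (bias D (M ^ 2) k)
  have hbias := bias_eq D (M ^ 2) k
  have hM2 : (0 : ℝ) < ((M ^ 2 : ℕ) : ℝ) := Nat.cast_pos.2 hN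
  have hinv : 1 / ((M ^ 2 : ℕ) : ℝ) ≤ 1 / M := by
    refine one_div_le_one_div_of_le (by linarith) ?_
    push_cast
    nlinarith
  have hdiv : (M : ℝ) / ((M ^ 2 : ℕ) : ℝ) = 1 / M := by
    push_cast
    field_simp
  have hip := integrable_hat_mul D (M ^ 2) k measurable_pred abs_pred_le_one
  have hio := integrable_hat_mul D (M ^ 2) k measurable_outcome abs_outcome_le_one
  have hi := integrable_hat D (M ^ 2) k
  rcases le_or_gt (k : ℕ) M with hlow | hlow
  · have hsupp : ∀ u : unitInterval, hat (M ^ 2) k u = 0 ∨ (u : ℝ) ≤ 2 / M := fun u =>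
      (hat_eq_zero_or hN k u).imp_right fun h => by
        have h1 : (k : ℝ) / ((M ^ 2 : ℕ) : ℝ) ≤ 1 / M := by
          rw [← hdiv]
          exact div_le_div_of_nonneg_right (Nat.cast_le.2 hlow) hM2.le
        have h2 := (abs_le.1 h).2
        rw [show (2 : ℝ) / M = 1 / M + 1 / M by ring]
        linarith
    have hp := integral_hat_mul_pred_le D hsupp
    refine ⟨pred, Prod.fst, fun b p => hat (M ^ 2) k p.1 * if b then pred p else outcome p,
      measurable_pred, measurable_fst, pred_nonneg, pred_le_one, ?_, ?_, ?_, ?_, ?_, ?_⟩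
    · intro S _
      simp [pred]
    · rintro (_ | _)
      exacts [hio, hip]
    · rintro (_ | _) p
      exacts [mul_nonneg (hat_nonneg _ _ _) (outcome_nonneg p),
        mul_nonneg (hat_nonneg _ _ _) (pred_nonneg p)]
    · intro p
      rw [sumDist_dLogit_self, ← ENNReal.ofReal_mul
        (mul_nonneg (hat_nonneg _ _ _) (pred_nonneg p))]
      refine ENNReal.ofReal_le_ofReal (mul_le_of_le_one_right
        (mul_nonneg (hat_nonneg _ _ _) (pred_nonneg p)) ?_)
      rw [if_pos rfl, abs_le]
      constructor <;> linarith [outcome_nonneg p, outcome_le_one p]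
    · intro p
      have h1 : 0 ≤ 1 - pred p := sub_nonneg.2 (pred_le_one p)
      rw [sumDist_dLogit_self, ← ENNReal.ofReal_mul (mul_nonneg (hat_nonneg _ _ _) h1)]
      refine ENNReal.ofReal_le_ofReal ?_
      simp only [Bool.false_eq_true, if_false, sub_zero, abs_of_nonneg (outcome_nonneg p)]
      refine mul_le_mul_of_nonneg_right ?_ (outcome_nonneg p)
      exact mul_le_of_le_one_right (hat_nonneg _ _ _) (by linarith [pred_nonneg p])
    · simp only [if_true, Bool.false_eq_true, if_false]
      change _ + massOne D (M ^ 2) k ≤ _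
      rw [show (4 : ℝ) / M = 2 / M + 2 / M by ring, add_mul]
      linarith
  rcases le_or_gt (M ^ 2) (k + M) with hhigh | hhigh
  · have hsupp : ∀ u : unitInterval, hat (M ^ 2) k u = 0 ∨ 1 - 2 / M ≤ (u : ℝ) := fun u =>
      (hat_eq_zero_or hN k u).imp_right fun h => by
        have h1 : 1 ≤ (k : ℝ) / ((M ^ 2 : ℕ) : ℝ) + 1 / M := by
          rw [← hdiv, ← add_div, one_le_div hM2]
          exact_mod_cast hhigh
        have h2 := (abs_le.1 h).1
        rw [show (2 : ℝ) / M = 1 / M + 1 / M by ring]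
        linarith
    have hp := le_integral_hat_mul_pred D hsupp
    have hp1 : ∀ p, 0 ≤ 1 - pred p := fun p => sub_nonneg.2 (pred_le_one p)
    have ho1 : ∀ p, 0 ≤ 1 - outcome p := fun p => sub_nonneg.2 (outcome_le_one p)
    have e : ∀ g : Pair → ℝ, ∀ p : Pair,
        hat (M ^ 2) k p.1 * (1 - g p) = hat (M ^ 2) k p.1 - hat (M ^ 2) k p.1 * g p :=
      fun g p => by ring
    refine ⟨pred, Prod.fst,
      fun b p => hat (M ^ 2) k p.1 * if b then 1 - outcome p else 1 - pred p,
      measurable_pred, measurable_fst, pred_nonneg, pred_le_one, ?_, ?_, ?_, ?_, ?_, ?_⟩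
    · intro S _
      simp [pred]
    · rintro (_ | _)
      · simp only [Bool.false_eq_true, if_false, e]
        exact hi.sub hip
      · simp only [if_true, e]
        exact hi.sub hio
    · rintro (_ | _) p
      exacts [mul_nonneg (hat_nonneg _ _ _) (hp1 p), mul_nonneg (hat_nonneg _ _ _) (ho1 p)]
    · intro p
      rw [sumDist_dLogit_self, ← ENNReal.ofReal_mul
        (mul_nonneg (hat_nonneg _ _ _) (pred_nonneg p))]
      refine ENNReal.ofReal_le_ofReal ?_
      simp only [if_true]
      rw [abs_sub_comm, abs_of_nonneg (ho1 p)]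
      exact mul_le_mul_of_nonneg_right
        (mul_le_of_le_one_right (hat_nonneg _ _ _) (pred_le_one p)) (ho1 p)
    · intro p
      rw [sumDist_dLogit_self, ← ENNReal.ofReal_mul (mul_nonneg (hat_nonneg _ _ _) (hp1 p))]
      refine ENNReal.ofReal_le_ofReal ?_
      simp only [Bool.false_eq_true, if_false, sub_zero, abs_of_nonneg (outcome_nonneg p)]
      exact mul_le_of_le_one_right (mul_nonneg (hat_nonneg _ _ _) (hp1 p)) (outcome_le_one p)
    · simp only [if_true, Bool.false_eq_true, if_false, e]
      rw [integral_sub hi hip, integral_sub hi hio]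
      change mass D (M ^ 2) k - massOne D (M ^ 2) k + (mass D (M ^ 2) k - _) ≤ _
      rw [show (4 : ℝ) / M = 2 / M + 2 / M by ring, add_mul]
      linarith
  · obtain ⟨q0, q1, h00, h01, h10, h11, hq, hcost⟩ := exists_relabelling
      (massOne_nonneg D (M ^ 2) k) (massOne_le_mass D (M ^ 2) k)
      (node (M ^ 2) k).2.1 (node (M ^ 2) k).2.2
    have hnode : ((node (M ^ 2) k : unitInterval) : ℝ) = (k : ℝ) / ((M ^ 2 : ℕ) : ℝ) := rfl
    have hk1 : 1 / M + 1 / ((M ^ 2 : ℕ) : ℝ) ≤ (k : ℝ) / ((M ^ 2 : ℕ) : ℝ) := by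
      rw [← hdiv, ← add_div]
      exact div_le_div_of_nonneg_right (by exact_mod_cast hlow) hM2.le
    have hk2 : (k : ℝ) / ((M ^ 2 : ℕ) : ℝ) + 1 / M + 1 / ((M ^ 2 : ℕ) : ℝ) ≤ 1 := by
      rw [← hdiv, ← add_div, ← add_div, div_le_one hM2]
      exact_mod_cast hhigh
    have hpos : 0 < 1 / ((M ^ 2 : ℕ) : ℝ) := by positivity
    have hMpos : (0 : ℝ) < 1 / M := by positivity
    have hdist : ∀ u : unitInterval, hat (M ^ 2) k u = 0 ∨
        dLogit u (node (M ^ 2) k) ≤ ENNReal.ofReal (2 / M) := fun u =>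
      (hat_eq_zero_or hN k u).imp_right fun h => by
        have h' := abs_le.1 h
        refine (dLogit_le (r := 1 / M) hMpos (by linarith) (by linarith) (by rw [hnode]; linarith)
          (by rw [hnode]; linarith)).trans (ENNReal.ofReal_le_ofReal ?_)
        rw [hnode, show (2 : ℝ) / M = 2 * (1 / M) by ring]
        refine mul_le_mul_of_nonneg_left ?_ zero_le_two
        rw [div_le_iff₀ hMpos]
        refine h.trans (le_of_eq ?_)
        push_cast
        field_simp
    have h2M : 0 ≤ (2 : ℝ) / M := by positivity
    refine ⟨fun p => q1 * outcome p + q0 * (1 - outcome p), fun _ => node (M ^ 2) k,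
      fun b p => hat (M ^ 2) k p.1 *
        ((if b then q1 * (2 / M) else (1 - q1) * (2 / M) + (1 - q1)) * outcome p +
        (if b then q0 * (2 / M) + q0 else (1 - q0) * (2 / M)) * (1 - outcome p)),
      ?_, measurable_const, ?_, ?_, ?_, ?_, ?_, ?_, ?_, ?_⟩
    · exact (measurable_outcome.const_mul _).add
        ((measurable_const.sub measurable_outcome).const_mul _)
    · rintro ⟨u, _ | _⟩ <;> simp [outcome, h00, h10]
    · rintro ⟨u, _ | _⟩ <;> simp [outcome, h01, h11]
    · intro S _
      refine setIntegral_preimage_const_eq_zero D ?_ S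
      have e : ∀ p : Pair, hat (M ^ 2) k p.1 *
          ((node (M ^ 2) k : ℝ) - (q1 * outcome p + q0 * (1 - outcome p))) =
        hat (M ^ 2) k p.1 * (((node (M ^ 2) k : ℝ) - q1) * outcome p +
          ((node (M ^ 2) k : ℝ) - q0) * (1 - outcome p)) := fun p => by ring
      simp only [e]
      rw [integral_hat_mul_affine]
      linarith
    · intro b
      have e : ∀ a c : ℝ, ∀ p : Pair, hat (M ^ 2) k p.1 * (a * outcome p + c * (1 - outcome p)) =
        (a - c) * (hat (M ^ 2) k p.1 * outcome p) + c * hat (M ^ 2) k p.1 := fun a c p => by ring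
      simp only [e]
      exact (hio.const_mul _).add (hi.const_mul _)
    · have h01' : 0 ≤ 1 - q0 := sub_nonneg.2 h01
      have h11' : 0 ≤ 1 - q1 := sub_nonneg.2 h11
      rintro (_ | _) ⟨u, _ | _⟩ <;> refine mul_nonneg (hat_nonneg _ _ _) ?_ <;>
        simp [outcome] <;> positivity
    · rintro ⟨u, b⟩
      rcases hdist u with h | h
      · simp [h]
      · cases b
        · simp only [outcome, sumDist, Bool.false_eq_true, if_true, if_false, mul_zero, zero_add,
            sub_zero, mul_one, zero_sub, abs_neg, abs_one]
          rw [ENNReal.ofReal_mul (hat_nonneg _ _ _),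
            show q0 * (2 / M) + q0 = q0 * (2 / M + 1) by ring, ENNReal.ofReal_mul (hat_nonneg _ _ _),
            ENNReal.ofReal_mul h00, ENNReal.ofReal_add h2M zero_le_one, mul_assoc]
          gcongr
        · simp only [outcome, sumDist, if_true, mul_one, sub_self, mul_zero, add_zero, abs_zero,
            ENNReal.ofReal_zero]
          rw [ENNReal.ofReal_mul (hat_nonneg _ _ _), ENNReal.ofReal_mul (hat_nonneg _ _ _),
            ENNReal.ofReal_mul h10, mul_assoc]
          gcongr
    · have h01' : 0 ≤ 1 - q0 := sub_nonneg.2 h01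
      have h11' : 0 ≤ 1 - q1 := sub_nonneg.2 h11
      rintro ⟨u, b⟩
      rcases hdist u with h | h
      · simp [h]
      · cases b
        · simp only [outcome, sumDist, Bool.false_eq_true, if_false, mul_zero, zero_add,
            sub_zero, mul_one, sub_self, abs_zero, ENNReal.ofReal_zero, add_zero]
          rw [ENNReal.ofReal_mul (hat_nonneg _ _ _), ENNReal.ofReal_mul (hat_nonneg _ _ _),
            ENNReal.ofReal_mul h01', mul_assoc]
          gcongr
        · simp only [outcome, sumDist, Bool.false_eq_true, if_true, if_false, mul_one, sub_self,
            mul_zero, add_zero, sub_zero, abs_one]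
          rw [show (1 - q1) * (2 / M) + (1 - q1) = (1 - q1) * (2 / M + 1) by ring,
            ENNReal.ofReal_mul (hat_nonneg _ _ _), ENNReal.ofReal_mul (hat_nonneg _ _ _),
            ENNReal.ofReal_mul h11', ENNReal.ofReal_add h2M zero_le_one, mul_assoc]
          gcongr
    · rw [integral_hat_mul_affine, integral_hat_mul_affine]
      simp only [if_true, Bool.false_eq_true, if_false]
      have h1 := abs_massOne_sub_le D hN k
      rw [← hnode, ← hcost] at h1
      have h2 := mul_le_mul_of_nonneg_right hinv hm
      have h3 : 0 ≤ 1 / M * mass D (M ^ 2) k := mul_nonneg hMpos.le hm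
      rw [show (4 : ℝ) / M = 2 / M + 1 / M + 1 / M by ring, add_mul, add_mul]
      linarith

theorem dCEOf_dLogit_le {M : ℕ} (hM : 0 < M) (D : ProbabilityMeasure Pair) :
    dCEOf dLogit D ≤ ENNReal.ofReal (4 / M + bucketError (M ^ 2) D) := by
  choose q t R hqm htm hq0 hq1 hcal hR hR0 h1 h2 hsum using exists_bucket_transport hM D
  obtain ⟨D', hD', h⟩ := exists_calibrated_wasserstein_le D
    (φ := fun k : Fin (M ^ 2 + 1) => fun p => hat (M ^ 2) k p.1) (q := q) (t := t)
    (fun k => (measurable_hat _ k).comp measurable_fst) hqm htm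
    (fun k p => hat_nonneg _ _ _) (fun p => sum_hat _ p.1) hq0 hq1 hcal
  refine (iInf₂_le D' hD').trans ((h _ R hR hR0 h1 h2).trans (ENNReal.ofReal_le_ofReal ?_))
  refine (Finset.sum_le_sum fun k _ => hsum k).trans (le_of_eq ?_)
  rw [Finset.sum_add_distrib, ← Finset.mul_sum, sum_mass, mul_one]
  rfl

end LogitBound

section Optimize

theorem pow_succ_le_of_forall_le {x y A B : ℝ} {k : ℕ} (hx : 0 ≤ x) (hy : 0 ≤ y) (hA : 0 < A)
    (hB : 0 ≤ B) (hxA : x ≤ 2 * A)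
    (h : ∀ N : ℕ, 0 < N → x ≤ A / N + B * N ^ k * y) :
    x ^ (k + 1) ≤ 2 * B * (4 * A) ^ k * y := by
  rcases hx.eq_or_lt with rfl | hx
  · rw [zero_pow k.succ_ne_zero]
    positivity
  have hq : 0 < 2 * A / x := by positivity
  set N := ⌈2 * A / x⌉₊ with hNdef
  have hN : 0 < N := Nat.ceil_pos.2 hq
  have hN' : (0 : ℝ) < N := Nat.cast_pos.2 hN
  have h1 : 2 * A / x ≤ N := Nat.le_ceil _
  have h2 : (N : ℝ) < 2 * A / x + 1 := Nat.ceil_lt_add_one hq.le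
  have h3 : A / N ≤ x / 2 := by
    rw [div_le_iff₀ hx] at h1
    rw [div_le_iff₀ hN']
    linarith
  have h4 : N * x ≤ 4 * A := by
    have h5 : (N : ℝ) * x ≤ (2 * A / x + 1) * x := mul_le_mul_of_nonneg_right h2.le hx.le
    rw [add_mul, div_mul_cancel₀ _ hx.ne'] at h5
    linarith
  have h5 : x ≤ 2 * (B * N ^ k * y) := by linarith [h N hN]
  calc x ^ (k + 1) = x ^ k * x := pow_succ _ _
    _ ≤ x ^ k * (2 * (B * N ^ k * y)) := mul_le_mul_of_nonneg_left h5 (by positivity)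
    _ = 2 * B * (N * x) ^ k * y := by rw [mul_pow]; ring
    _ ≤ 2 * B * (4 * A) ^ k * y := by gcongr

theorem dCE_ne_top (D : ProbabilityMeasure Pair) : dCE D ≠ ∞ :=
  ne_top_of_le_ne_top ENNReal.ofReal_ne_top (dCE_le one_pos D)

theorem dCEOf_dLogit_ne_top (D : ProbabilityMeasure Pair) : dCEOf dLogit D ≠ ∞ :=
  ne_top_of_le_ne_top ENNReal.ofReal_ne_top (dCEOf_dLogit_le one_pos D)

theorem toReal_dCE_pow_le (D : ProbabilityMeasure Pair) :
    (dCE D).toReal ^ 3 ≤ 256 * wCE dLogit D := by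
  have hb : ∀ N : ℕ, 0 < N → (dCE D).toReal ≤ 2 / N + bucketError N D := fun N hN =>
    ENNReal.toReal_le_of_le_ofReal (add_nonneg (by positivity) (bucketError_nonneg N D))
      (dCE_le hN D)
  refine (pow_succ_le_of_forall_le (k := 2) (A := 2) (B := 2) ENNReal.toReal_nonneg
    (wCE_nonneg dLogit D) two_pos two_pos.le ?_ fun N hN => ?_).trans (le_of_eq (by norm_num))
  · have := hb 1 one_pos
    have := bucketError_le_one 1 D
    norm_num at *
    linarith
  · exact (hb N hN).trans (add_le_add le_rfl (bucketError_le_wCE hN D))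

theorem toReal_dCEOf_dLogit_pow_le (D : ProbabilityMeasure Pair) :
    (dCEOf dLogit D).toReal ^ 5 ≤ 393216 * (dCE D).toReal := by
  have hb : ∀ M : ℕ, 0 < M → (dCEOf dLogit D).toReal ≤ 4 / M + bucketError (M ^ 2) D :=
    fun M hM => ENNReal.toReal_le_of_le_ofReal
      (add_nonneg (by positivity) (bucketError_nonneg _ D)) (dCEOf_dLogit_le hM D)
  refine (pow_succ_le_of_forall_le (k := 4) (A := 4) (B := 3) ENNReal.toReal_nonneg
    (y := (dCE D).toReal) ENNReal.toReal_nonneg four_pos three_pos.le ?_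
    fun M hM => ?_).trans (le_of_eq (by norm_num))
  · have := hb 1 one_pos
    have := bucketError_le_one (1 ^ 2) D
    norm_num at *
    linarith
  · refine (hb M hM).trans (add_le_add le_rfl ?_)
    have h := bucketError_le_dCE (N := M ^ 2) (by positivity) D
    rw [ENNReal.ofReal_le_iff_le_toReal
      (ENNReal.mul_ne_top ENNReal.ofReal_ne_top (dCE_ne_top D)), ENNReal.toReal_mul,
      ENNReal.toReal_ofReal (by positivity)] at h
    refine h.trans (le_of_eq ?_)
    push_cast
    ring

theorem ofReal_mul_dCE_rpow_le {c y : ℝ} (hc : 0 < c) {D : ProbabilityMeasure Pair}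
    (h : (dCE D).toReal ^ 3 ≤ c * y) :
    ENNReal.ofReal c⁻¹ * dCE D ^ (3 : ℝ) ≤ ENNReal.ofReal y := by
  rw [← ENNReal.ofReal_toReal (dCE_ne_top D), ENNReal.ofReal_rpow_of_nonneg
    ENNReal.toReal_nonneg (by norm_num), ← ENNReal.ofReal_mul (by positivity)]
  refine ENNReal.ofReal_le_ofReal ?_
  rw [inv_mul_le_iff₀ hc]
  exact_mod_cast h

theorem dCEOf_dLogit_le_rpow (D : ProbabilityMeasure Pair) :
    dCEOf dLogit D ≤ ENNReal.ofReal 393216 * dCE D ^ (1 / 5 : ℝ) := by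
  have hx : 0 ≤ (dCE D).toReal := ENNReal.toReal_nonneg
  have hz : 0 ≤ (dCEOf dLogit D).toReal := ENNReal.toReal_nonneg
  rw [← ENNReal.ofReal_toReal (dCE_ne_top D), ← ENNReal.ofReal_toReal (dCEOf_dLogit_ne_top D),
    ENNReal.ofReal_rpow_of_nonneg hx (by norm_num), ← ENNReal.ofReal_mul (by norm_num)]
  refine ENNReal.ofReal_le_ofReal ?_
  have h := Real.rpow_le_rpow (z := 1 / 5) (by positivity) (toReal_dCEOf_dLogit_pow_le D)
    (by norm_num)
  rw [Real.mul_rpow (by norm_num) hx, ← Real.rpow_natCast, ← Real.rpow_mul hz] at h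
  norm_num at h
  refine h.trans (mul_le_mul_of_nonneg_right ?_ (by positivity))
  exact Real.rpow_le_self_of_one_le (by norm_num) (by norm_num)

end Optimize

end Calibration

end

theorem mainTheorem10 :
    Calibration.IsConsistentCalibrationMeasure (Calibration.wCE Calibration.dLogit) ∧
    (∀ D : ProbabilityMeasure Calibration.Pair,
      Calibration.dCEOf Calibration.dLogit D ≠ ∞) ∧
    Calibration.IsConsistentCalibrationMeasure
      (fun D => (Calibration.dCEOf Calibration.dLogit D).toReal) := by
  refine ⟨⟨Calibration.wCE_nonneg _, 256⁻¹, 2 * 393216, 3, 1 / 5, by norm_num, by norm_num,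
    by norm_num, by norm_num, fun D => ⟨?_, ?_⟩⟩, Calibration.dCEOf_dLogit_ne_top,
    ⟨fun _ => ENNReal.toReal_nonneg, 512⁻¹, 393216, 3, 1 / 5, by norm_num, by norm_num,
      by norm_num, by norm_num, fun D => ⟨?_, ?_⟩⟩⟩
  · exact Calibration.ofReal_mul_dCE_rpow_le (by norm_num) (Calibration.toReal_dCE_pow_le D)
  · rw [ENNReal.ofReal_mul zero_le_two, mul_assoc, ENNReal.ofReal_ofNat 2]
    exact (Calibration.ofReal_wCE_le_dCEOf D).trans
      (mul_le_mul_right (Calibration.dCEOf_dLogit_le_rpow D) _)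
  · refine Calibration.ofReal_mul_dCE_rpow_le (by norm_num)
      ((Calibration.toReal_dCE_pow_le D).trans ?_)
    have h := Calibration.ofReal_wCE_le_dCEOf D
    rw [ENNReal.ofReal_le_iff_le_toReal (ENNReal.mul_ne_top ENNReal.ofNat_ne_top
      (Calibration.dCEOf_dLogit_ne_top D)), ENNReal.toReal_mul, ENNReal.toReal_ofNat] at h
    linarith
  · rw [ENNReal.ofReal_toReal (Calibration.dCEOf_dLogit_ne_top D)]
    exact Calibration.dCEOf_dLogit_le_rpow D
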